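/- Let $F,G\in\mathbb C[X_1,\dots,X_n]$ be coprime, both also coprime with $X_1\cdots X_n$, and let $\gamma\in\mathbb Z^n$. Write ${\rm Supp}\,F\subset\mathbb N^n$ for the set of exponents of $F$, $\Delta(F)$ for its convex hull in $\mathbb R^n$ (the Newton polytope), and $$\mathcal A_F=\{(\log|z_1|,\dots,\log|z_n|) : z\in(\mathbb C^*)^n,\ F(z)=0\}$$ for the amoeba of $F$. A connected component $E$ of $\mathbb R^n\setminus\mathcal A_F$ has order $\alpha\in\mathbb Z^n$ if, for every $\zeta\in(\mathbb C^*)^n$ with $(\log|\zeta_1|,\dots,\log|\zeta_n|)\in E$ and every $j$, the loop $\theta\in\mathbb R/2\pi\mathbb Z\mapsto F(\zeta_1,\dots,\zeta_je^{i\theta},\dots,\zeta_n)$ has degree (winding number about $0$) $\alpha_j$. There is at most one component of order $\alpha$; it is denoted $E_\alpha$ (and $E_\alpha=\emptyset$ if there is none). A discrete $n$-rational filter with transfer function $X^\gamma G/F$ is a system $S:u\mapsto\big(\sum_{\kappa\in\mathbb Z^n}h_\kappa u_{k-\kappa}\big)_{k\in\mathbb Z^n}$, acting on finitely supported $u:\mathbb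 Z^n\to\mathbb C$, which is realizable, that is, its impulse response $h:\mathbb Z^n\to\mathbb C$ vanishes outside some translate $M+\mathbb N^n$ ($M\in\mathbb Z^n$), and which satisfies $F(X)\cdot\sum_{k}h_kX^k=X^\gamma G(X)$ coefficientwise. It is (strongly) BIBO stable if $\sum_{k\in\mathbb Z^n}|h_k|<+\infty$. **Theorem.** Suppose that $\dim\Delta(F)=n$ and that the origin $\underline 0$ of $\mathbb R^n$ does not lie in $\mathcal A_F$, i.e. $F$ has no zeros on the unit torus $\{|z_1|=\dots=|z_n|=1\}$. Then a discrete $n$-rational filter $S$ with transfer function $X^\gamma G/F$ is BIBO stable if and only if $\boldsymbol 0\in{\rm Supp}\,F$ and $\underline 0\in E_{\boldsymbol 0}$. Moreover, a BIBO stable discrete $n$-rational filter with transfer function $X^\gamma G/F$ exists if and only if $\boldsymbol 0\in{\rm Supp}\,F$ and $\underline 0\in E_{\boldsymbol 0}$. -/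

import Mathlib

open Complex

/-! ### Discrete linear time-invariant systems -/

/-- A discrete system on `ℤⁿ`: it sends finitely supported input signals to output signals. -/
abbrev DiscreteSystem (n : ℕ) : Type :=
  ((Fin n → ℤ) →₀ ℂ) → ((Fin n → ℤ) → ℂ)

/-- The impulse response: the output produced by the unit impulse at the origin. -/
noncomputable def impulseResponse {n : ℕ} (S : DiscreteSystem n) : (Fin n → ℤ) → ℂ :=
  S (Finsupp.single 0 1)

/-- `S` is linear and time invariant: it is the convolution with its impulse response `h`,
`(S u)_k = ∑_κ h_κ u_{k-κ}`, written here as a finite sum over the points `m = k - κ` of the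
support of `u`. -/
def IsLTI {n : ℕ} (S : DiscreteSystem n) : Prop :=
  ∀ (u : (Fin n → ℤ) →₀ ℂ) (k : Fin n → ℤ),
    S u k = ∑ m ∈ u.support, impulseResponse S (k - m) * u m

/-- (Strong) BIBO stability: the impulse response belongs to `ℓ¹(ℤⁿ)`. -/
def IsBIBOStable {n : ℕ} (S : DiscreteSystem n) : Prop :=
  Summable fun k : Fin n → ℤ => ‖impulseResponse S k‖

/-- An exponent in `ℕⁿ`, seen in `ℤⁿ`. -/
def intExponent {n : ℕ} (a : Fin n →₀ ℕ) : Fin n → ℤ := fun i => (a i : ℤ)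

/-- The Laurent coefficients of `X^γ G`: the coefficient of `X^k`, for `k ∈ ℤⁿ`. -/
noncomputable def shiftedCoeff {n : ℕ} (γ : Fin n → ℤ) (G : MvPolynomial (Fin n) ℂ)
    (k : Fin n → ℤ) : ℂ :=
  ∑ b ∈ G.support, if k = γ + intExponent b then G.coeff b else 0

/-- `S` is a (realizable) discrete filter with transfer function `X^γ G / F`, where `X_j` is the
unit delay in the `j`-th direction.  It is linear and time invariant, its impulse response `h`
vanishes outside a translate of the orthant `ℕⁿ`, and the formal series `∑_k h_k X^k`
satisfies `F · ∑_k h_k X^k = X^γ G`, coefficient by coefficient. -/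
structure IsRationalFilter {n : ℕ} (S : DiscreteSystem n) (γ : Fin n → ℤ)
    (G F : MvPolynomial (Fin n) ℂ) : Prop where
  lti : IsLTI S
  realizable : ∃ M : Fin n → ℤ, ∀ k, impulseResponse S k ≠ 0 → M ≤ k
  transfer : ∀ k : Fin n → ℤ,
    ∑ a ∈ F.support, F.coeff a * impulseResponse S (k - intExponent a) = shiftedCoeff γ G k

/-! ### Newton polytope and amoeba -/

/-- The Newton polytope: the convex hull in `ℝⁿ` of the exponents of `F`. -/
def newtonPolytope {n : ℕ} (F : MvPolynomial (Fin n) ℂ) : Set (Fin n → ℝ) :=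
  convexHull ℝ ((fun (a : Fin n →₀ ℕ) (i : Fin n) => (a i : ℝ)) '' (F.support : Set (Fin n →₀ ℕ)))

/-- The map `z ↦ (log |z₁|, …, log |zₙ|)`; it is used only at points of `(ℂ*)ⁿ`. -/
noncomputable def logMap {n : ℕ} (z : Fin n → ℂ) : Fin n → ℝ := fun i => Real.log ‖z i‖

/-- The amoeba: the image under `logMap` of the zeros of `F` in `(ℂ*)ⁿ`. -/
def amoeba {n : ℕ} (F : MvPolynomial (Fin n) ℂ) : Set (Fin n → ℝ) :=
  logMap '' {z : Fin n → ℂ | (∀ i, z i ≠ 0) ∧ MvPolynomial.eval z F = 0}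

/-- The connected components of the complement of the amoeba. -/
def complementComponents {n : ℕ} (F : MvPolynomial (Fin n) ℂ) : Set (Set (Fin n → ℝ)) :=
  {E | ∃ x ∈ (amoeba F)ᶜ, E = connectedComponentIn (amoeba F)ᶜ x}

/-- The `2π`-periodic loop `f` in `ℂ*` has degree (winding number about `0`) equal to `d`: along
some continuous logarithm of `f`, the increment over a period is `2πi d`. -/
def HasLoopDegree (f : ℝ → ℂ) (d : ℤ) : Prop :=
  ∃ g : ℝ → ℂ, Continuous g ∧ (∀ θ, exp (g θ) = f θ) ∧
    g (2 * Real.pi) - g 0 = 2 * Real.pi * I * d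

/-- The component `E` has order (multiplicity) `α`: for each point `ζ ∈ (ℂ*)ⁿ` over `E` and each
`j`, the loop `θ ↦ F(ζ₁, …, ζⱼ e^{iθ}, …, ζₙ)` has degree `αⱼ`. -/
def HasOrder {n : ℕ} (F : MvPolynomial (Fin n) ℂ) (E : Set (Fin n → ℝ)) (α : Fin n → ℤ) : Prop :=
  ∀ ζ : Fin n → ℂ, (∀ i, ζ i ≠ 0) → logMap ζ ∈ E → ∀ j : Fin n,
    HasLoopDegree
      (fun θ => MvPolynomial.eval (Function.update ζ j (ζ j * exp (θ * I))) F) (α j)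

/-- `E_α`, the complement component of order `α` (there is at most one), empty if there is none. -/
def componentOfOrder {n : ℕ} (F : MvPolynomial (Fin n) ℂ) (α : Fin n → ℤ) : Set (Fin n → ℝ) :=
  ⋃₀ {E | E ∈ complementComponents F ∧ HasOrder F E α}

/-! ### Winding numbers of loops -/

/-! As `F` has no zero on the unit torus, both sides amount to `F` having no zero in the closed unit
polydisc.

Order and polydisc: along a unit circle the degree of a one-variable polynomial counts its roots in
the disc. If the degrees on the torus all vanish, circles can be filled to discs one coordinate at a
time: non-vanishing at one stage lets the next degree be transported over a connected set
(`eval_ne_zero_of_hasLoopDegree_zero`). In particular `F` is nonzero at the origin, so `0` is in its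
support.

Polydisc to stability: convolution by `F` on `ℓ¹(ℤⁿ)` is a polynomial in commuting contractions.
Characters of the closed algebra they generate send them into the closed polydisc, so Gelfand theory
inverts `F` there, and closedness keeps the inverse kernel in the orthant
(`exists_summable_inverse`). A nonzero constant term makes the realizable impulse response unique,
so every filter with this transfer function is the stable one.

Stability to order: a summable impulse response gives `F · H = z^c G` on the closed polydisc.
Coprime polynomials in several variables may still share zeros, so this does not exclude zeros of
`F` directly. By elimination there are none on the line in direction `j` through a suitable torus
point (`exists_torus_no_common_zero`). There the `j`-th degree is zero, and homotopy invariance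
carries this to the whole component. -/

lemma HasLoopDegree.mul {f g : ℝ → ℂ} {d e : ℤ} (hf : HasLoopDegree f d)
    (hg : HasLoopDegree g e) : HasLoopDegree (fun θ => f θ * g θ) (d + e) := by
  obtain ⟨u, hu, hu', hud⟩ := hf
  obtain ⟨v, hv, hv', hve⟩ := hg
  refine ⟨fun θ => u θ + v θ, hu.add hv, fun θ => by rw [exp_add, hu', hv'], ?_⟩
  push_cast
  linear_combination hud + hve

lemma hasLoopDegree_zero_of_mem_slitPlane {q : ℝ → ℂ} (hq : Continuous q)
    (hs : ∀ θ, q θ ∈ slitPlane) (hp : q (2 * Real.pi) = q 0) : HasLoopDegree q 0 :=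
  ⟨fun θ => log (q θ), hq.clog hs, fun θ => exp_log (slitPlane_ne_zero (hs θ)), by simp [hp]⟩

lemma hasLoopDegree_const {c : ℂ} (hc : c ≠ 0) : HasLoopDegree (fun _ => c) 0 :=
  ⟨fun _ => log c, continuous_const, fun _ => exp_log hc, by simp⟩

lemma hasLoopDegree_exp : HasLoopDegree (fun θ : ℝ => exp (θ * I)) 1 :=
  ⟨fun θ => θ * I, by fun_prop, fun _ => rfl, by push_cast; ring⟩

/-- Two continuous logarithms of a loop differ by `2πi` times a continuous integer-valued function,
which is constant. -/
lemma HasLoopDegree.unique {f : ℝ → ℂ} {d e : ℤ} (hd : HasLoopDegree f d)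
    (he : HasLoopDegree f e) : d = e := by
  obtain ⟨u, hu, hu', hud⟩ := hd
  obtain ⟨v, hv, hv', hve⟩ := he
  have key : ∀ θ, ∃ m : ℤ, u θ = v θ + m * (2 * Real.pi * I) := fun θ =>
    exp_eq_exp_iff_exists_int.1 ((hu' θ).trans (hv' θ).symm)
  choose m hm using key
  have hpi : (2 * Real.pi * I : ℂ) ≠ 0 := two_pi_I_ne_zero
  have hcont : Continuous fun θ => ((m θ : ℤ) : ℝ) := by
    have : (fun θ => ((m θ : ℤ) : ℝ)) = fun θ => ((u θ - v θ) / (2 * Real.pi * I)).re := by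
      funext θ
      rw [hm θ, add_sub_cancel_left, mul_div_cancel_right₀ _ hpi, intCast_re]
    rw [this]
    exact continuous_re.comp ((hu.sub hv).div_const _)
  have hm_cont : Continuous m := Int.isClosedEmbedding_coe_real.isInducing.continuous_iff.2 hcont
  have hconst : m (2 * Real.pi) = m 0 :=
    PreconnectedSpace.constant inferInstance hm_cont
  have h1 := hm (2 * Real.pi)
  have h2 := hm 0
  rw [hconst] at h1
  have : (2 * Real.pi * I : ℂ) * d = 2 * Real.pi * I * e := by
    linear_combination h1 - h2 - hud + hve
  exact_mod_cast mul_left_cancel₀ hpi this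

/-- A Rouché-type statement: loops that stay close to each other have the same degree. -/
lemma HasLoopDegree.of_norm_sub_lt {f g : ℝ → ℂ} {d : ℤ} (hf : HasLoopDegree f d)
    (hcf : Continuous f) (hcg : Continuous g) (hpf : f (2 * Real.pi) = f 0)
    (hpg : g (2 * Real.pi) = g 0) (h : ∀ θ, ‖g θ - f θ‖ < ‖f θ‖) : HasLoopDegree g d := by
  have hf0 : ∀ θ, f θ ≠ 0 := fun θ => norm_pos_iff.1 ((norm_nonneg _).trans_lt (h θ))
  -- The quotient stays in the open unit disc about `1`, where the principal logarithm is
  -- continuous.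
  have hq : HasLoopDegree (fun θ => g θ / f θ) 0 := by
    refine hasLoopDegree_zero_of_mem_slitPlane (hcg.div hcf hf0) (fun θ => ?_) (by rw [hpf, hpg])
    have : g θ / f θ = 1 + (g θ - f θ) / f θ := by field_simp [hf0 θ]; ring
    rw [this]
    apply mem_slitPlane_of_norm_lt_one
    rw [norm_div, div_lt_one (norm_pos_iff.2 (hf0 θ))]
    exact h θ
  have := hf.mul hq
  rw [add_zero] at this
  convert this using 2 with θ
  rw [mul_div_cancel₀ _ (hf0 θ)]

/-- Symmetric form of `HasLoopDegree.of_norm_sub_lt`. -/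
lemma hasLoopDegree_iff_of_norm_sub_lt {f g : ℝ → ℂ} {d : ℤ}
    (hcf : Continuous f) (hcg : Continuous g) (hpf : f (2 * Real.pi) = f 0)
    (hpg : g (2 * Real.pi) = g 0) (h : ∀ θ, ‖g θ - f θ‖ < ‖f θ‖)
    (h' : ∀ θ, ‖g θ - f θ‖ < ‖g θ‖) : HasLoopDegree f d ↔ HasLoopDegree g d :=
  ⟨fun H => H.of_norm_sub_lt hcf hcg hpf hpg h,
   fun H => H.of_norm_sub_lt hcg hcf hpg hpf fun θ => by rw [norm_sub_rev]; exact h' θ⟩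

/-- Homotopy invariance of the degree along a connected family of loops. -/
lemma hasLoopDegree_iff_of_isPreconnected {Y : Type*} [TopologicalSpace Y] {f : Y → ℝ → ℂ}
    (hf : Continuous fun p : Y × ℝ => f p.1 p.2) (hper : ∀ y, Function.Periodic (f y) (2 * Real.pi))
    {s : Set Y} (hs : IsPreconnected s) (h0 : ∀ y ∈ s, ∀ θ, f y θ ≠ 0) {x y : Y} (hx : x ∈ s)
    (hy : y ∈ s) {d : ℤ} : HasLoopDegree (f x) d ↔ HasLoopDegree (f y) d := by
  have hc : ∀ y, Continuous (f y) := fun y => hf.comp (by fun_prop : Continuous fun θ : ℝ => (y, θ))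
  have hp : ∀ y, f y (2 * Real.pi) = f y 0 := fun y => by simpa using hper y 0
  refine hs.induction₂ (fun x y => HasLoopDegree (f x) d ↔ HasLoopDegree (f y) d) ?_
    (fun _ _ _ _ _ _ h₁ h₂ => h₁.trans h₂) (fun _ _ _ _ h => h.symm) hx hy
  intro x hx
  -- Compactness of one period makes the closeness uniform in `θ`; periodicity then extends it to
  -- all `θ`. Hence the degree is locally constant.
  have hev : ∀ᶠ y in nhds x, ∀ θ ∈ Set.Icc (0 : ℝ) (2 * Real.pi),
      ‖f y θ - f x θ‖ < ‖f x θ‖ ∧ ‖f y θ - f x θ‖ < ‖f y θ‖ := by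
    apply isCompact_Icc.eventually_forall_of_forall_eventually
    intro θ _
    have c1 : Continuous fun z : Y × ℝ => ‖f z.1 z.2 - f x z.2‖ :=
      (hf.sub ((hc x).comp continuous_snd)).norm
    have c2 : Continuous fun z : Y × ℝ => ‖f x z.2‖ := ((hc x).comp continuous_snd).norm
    have hpos : ‖f x θ - f x θ‖ < ‖f x θ‖ := by simpa using h0 x hx θ
    exact (c1.continuousAt.eventually_lt c2.continuousAt hpos).and
      (c1.continuousAt.eventually_lt hf.norm.continuousAt hpos)
  filter_upwards [nhdsWithin_le_nhds hev] with y hy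
  have hall : ∀ θ, ‖f y θ - f x θ‖ < ‖f x θ‖ ∧ ‖f y θ - f x θ‖ < ‖f y θ‖ := by
    intro θ
    have hyx : Function.Periodic (fun t => (f y t, f x t)) (2 * Real.pi) := fun t =>
      Prod.ext (hper y t) (hper x t)
    obtain ⟨t, ht, hft⟩ := hyx.exists_mem_Ico₀ Real.two_pi_pos θ
    obtain ⟨h1, h2⟩ := Prod.mk.inj hft
    rw [h1, h2]
    exact hy t (Set.Ico_subset_Icc_self ht)
  exact hasLoopDegree_iff_of_norm_sub_lt (hc x) (hc y) (hp x) (hp y) (fun θ => (hall θ).1)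
    (fun θ => (hall θ).2)

lemma hasLoopDegree_exp_sub_of_norm_lt {a : ℂ} (ha : ‖a‖ < 1) :
    HasLoopDegree (fun θ : ℝ => exp (θ * I) - a) 1 := by
  refine hasLoopDegree_exp.of_norm_sub_lt (by fun_prop) (by fun_prop) ?_ ?_ ?_
  · simp [exp_two_pi_mul_I]
  · simp [exp_two_pi_mul_I]
  · intro θ
    simpa [norm_exp_ofReal_mul_I] using ha

lemma hasLoopDegree_exp_sub_of_lt_norm {a : ℂ} (ha : 1 < ‖a‖) :
    HasLoopDegree (fun θ : ℝ => exp (θ * I) - a) 0 := by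
  have ha0 : -a ≠ 0 := neg_ne_zero.2 (norm_pos_iff.1 (one_pos.trans ha))
  refine (hasLoopDegree_const ha0).of_norm_sub_lt (by fun_prop) (by fun_prop) rfl ?_ ?_
  · simp [exp_two_pi_mul_I]
  · intro θ
    simpa [norm_exp_ofReal_mul_I] using ha

/-- The degree of a polynomial along the unit circle is the number of its roots in the disc. -/
lemma hasLoopDegree_multiset_prod (s : Multiset ℂ) (hs : ∀ a ∈ s, ‖a‖ ≠ 1) :
    HasLoopDegree (fun θ : ℝ => (s.map fun a => exp (θ * I) - a).prod)
      (s.countP (fun a => ‖a‖ < 1)) := by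
  classical
  induction s using Multiset.induction_on with
  | empty => simpa using hasLoopDegree_const one_ne_zero
  | cons a s ih =>
    have ih' := ih fun b hb => hs b (Multiset.mem_cons_of_mem hb)
    simp only [Multiset.map_cons, Multiset.prod_cons, Multiset.countP_cons]
    rcases lt_or_gt_of_ne (hs a (Multiset.mem_cons_self a s)) with h | h
    · rw [if_pos h]
      push_cast
      rw [add_comm]
      exact (hasLoopDegree_exp_sub_of_norm_lt h).mul ih'
    · rw [if_neg (not_lt.2 h.le)]
      have := (hasLoopDegree_exp_sub_of_lt_norm h).mul ih'
      simpa using this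

/-- By factorization the degree is the number of roots in the open disc, with multiplicity; the
circle is excluded by hypothesis. -/
lemma hasLoopDegree_eval_iff (p : Polynomial ℂ) (hp : ∀ w : ℂ, ‖w‖ = 1 → p.eval w ≠ 0) :
    HasLoopDegree (fun θ : ℝ => p.eval (exp (θ * I))) 0 ↔ ∀ w : ℂ, ‖w‖ ≤ 1 → p.eval w ≠ 0 := by
  have hp0 : p ≠ 0 := by
    rintro rfl
    exact hp 1 (by simp) (by simp)
  have hdeg : HasLoopDegree (fun θ : ℝ => p.eval (exp (θ * I)))
      (p.roots.countP (fun a => ‖a‖ < 1)) := by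
    have h1 := (hasLoopDegree_const (Polynomial.leadingCoeff_ne_zero.2 hp0)).mul
      (hasLoopDegree_multiset_prod p.roots fun a ha h => hp a h (Polynomial.isRoot_of_mem_roots ha))
    rw [zero_add] at h1
    convert h1 using 2 with θ
    conv_lhs => rw [(IsAlgClosed.splits p).eq_prod_roots]
    simp [Polynomial.eval_multiset_prod, Multiset.map_map]
  have hcount : (p.roots.countP (fun a => ‖a‖ < 1) : ℤ) = 0 ↔
      ∀ w : ℂ, ‖w‖ ≤ 1 → p.eval w ≠ 0 := by
    rw [Int.natCast_eq_zero, Multiset.countP_eq_zero]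
    refine ⟨fun h w hw h0 => ?_, fun h a ha ha1 => h a ha1.le (Polynomial.isRoot_of_mem_roots ha)⟩
    rcases hw.lt_or_eq with hw | hw
    · exact h w ((Polynomial.mem_roots hp0).2 h0) hw
    · exact hp w hw h0
  rw [← hcount]
  exact ⟨fun h => (hdeg.unique h), fun h => by rw [← h]; exact hdeg⟩

/-! ### Zeros in the closed polydisc -/

section Winding

variable {n : ℕ}

/-- The loop of values of `F` obtained by turning the `j`-th coordinate of `ζ`. -/
noncomputable def coordLoop (F : MvPolynomial (Fin n) ℂ) (j : Fin n) (ζ : Fin n → ℂ) (θ : ℝ) : ℂ :=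
  MvPolynomial.eval (Function.update ζ j (ζ j * exp (θ * I))) F

lemma continuous_coordLoop (F : MvPolynomial (Fin n) ℂ) (j : Fin n) :
    Continuous fun p : (Fin n → ℂ) × ℝ => coordLoop F j p.1 p.2 := by
  refine (MvPolynomial.continuous_eval F).comp ?_
  exact continuous_fst.update j (by fun_prop)

lemma coordLoop_periodic (F : MvPolynomial (Fin n) ℂ) (j : Fin n) (ζ : Fin n → ℂ) :
    Function.Periodic (coordLoop F j ζ) (2 * Real.pi) := fun θ => by
  have : exp (((θ + 2 * Real.pi : ℝ) : ℂ) * I) = exp (θ * I) := by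
    push_cast
    rw [add_mul, exp_periodic]
  rw [coordLoop, coordLoop, this]

/-- The restriction of `F` to the line through `ζ` in the `j`-th direction. -/
lemma exists_polynomial_eval_update (F : MvPolynomial (Fin n) ℂ) (j : Fin n) (ζ : Fin n → ℂ) :
    ∃ p : Polynomial ℂ, ∀ w : ℂ,
      p.eval w = MvPolynomial.eval (Function.update ζ j (ζ j * w)) F := by
  refine ⟨MvPolynomial.aeval (Function.update (fun i => Polynomial.C (ζ i)) j
    (Polynomial.C (ζ j) * Polynomial.X)) F, fun w => ?_⟩
  have h : ((Polynomial.aeval w).comp (MvPolynomial.aeval (Function.update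
      (fun i => Polynomial.C (ζ i)) j (Polynomial.C (ζ j) * Polynomial.X))) :
        MvPolynomial (Fin n) ℂ →ₐ[ℂ] ℂ) =
      MvPolynomial.aeval (Function.update ζ j (ζ j * w)) := by
    ext i
    rcases eq_or_ne i j with rfl | hi
    · simp
    · simp [hi]
  simpa [Polynomial.coe_aeval_eq_eval, MvPolynomial.coe_aeval_eq_eval] using DFunLike.congr_fun h F

lemma hasLoopDegree_coordLoop_iff (F : MvPolynomial (Fin n) ℂ) (j : Fin n) (ζ : Fin n → ℂ)
    (hF : ∀ w : ℂ, ‖w‖ = 1 → MvPolynomial.eval (Function.update ζ j (ζ j * w)) F ≠ 0) :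
    HasLoopDegree (coordLoop F j ζ) 0 ↔
      ∀ w : ℂ, ‖w‖ ≤ 1 → MvPolynomial.eval (Function.update ζ j (ζ j * w)) F ≠ 0 := by
  obtain ⟨p, hp⟩ := exists_polynomial_eval_update F j ζ
  simp only [← hp] at hF ⊢
  rw [← hasLoopDegree_eval_iff p hF]
  have : coordLoop F j ζ = fun θ : ℝ => p.eval (exp (θ * I)) := by
    funext θ
    rw [hp, coordLoop]
  rw [this]

/-- Points of the closed polydisc all of whose coordinates outside `s` are on the unit circle. -/
def partialPolydisc (s : Finset (Fin n)) : Set (Fin n → ℂ) :=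
  Set.univ.pi fun i => if i ∈ s then Metric.closedBall 0 1 else Metric.sphere 0 1

lemma mem_partialPolydisc {s : Finset (Fin n)} {z : Fin n → ℂ} :
    z ∈ partialPolydisc s ↔ ∀ i, ‖z i‖ ≤ 1 ∧ (i ∉ s → ‖z i‖ = 1) := by
  simp only [partialPolydisc, Set.mem_univ_pi]
  refine forall_congr' fun i => ?_
  by_cases hi : i ∈ s
  · simp [hi]
  · simp only [hi, if_false, mem_sphere_zero_iff_norm, not_false_eq_true, forall_const]
    exact ⟨fun h => ⟨h.le, h⟩, fun h => h.2⟩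

lemma isPreconnected_partialPolydisc (s : Finset (Fin n)) :
    IsPreconnected (partialPolydisc s) := by
  refine isPreconnected_univ_pi fun i => ?_
  split_ifs
  · exact (convex_closedBall _ _).isPreconnected
  · exact isPreconnected_sphere (by simp [rank_real_complex]) _ _

lemma update_mul_mem_partialPolydisc {s : Finset (Fin n)} {z : Fin n → ℂ}
    (hz : z ∈ partialPolydisc s) (j : Fin n) {w : ℂ} (hw : ‖w‖ = 1) :
    Function.update z j (z j * w) ∈ partialPolydisc s := by
  rw [mem_partialPolydisc] at hz ⊢
  intro i
  rcases eq_or_ne i j with rfl | hi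
  · simpa [hw] using hz i
  · simpa [hi] using hz i

/-- If all the winding numbers of `F` on the unit torus vanish then `F` has no zero in the closed
unit polydisc. -/
lemma eval_ne_zero_of_hasLoopDegree_zero (F : MvPolynomial (Fin n) ℂ)
    (hF : ∀ z : Fin n → ℂ, (∀ i, ‖z i‖ = 1) → MvPolynomial.eval z F ≠ 0)
    (hdeg : ∀ j, HasLoopDegree (coordLoop F j fun _ => 1) 0)
    (z : Fin n → ℂ) (hz : ∀ i, ‖z i‖ ≤ 1) : MvPolynomial.eval z F ≠ 0 := by
  have key : ∀ s : Finset (Fin n), ∀ z ∈ partialPolydisc s, MvPolynomial.eval z F ≠ 0 := by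
    intro s
    induction s using Finset.induction_on with
    | empty => exact fun z hz => hF z fun i => (mem_partialPolydisc.1 hz i).2 (Finset.notMem_empty i)
    | insert j s hj ih =>
      intro z hz
      rw [mem_partialPolydisc] at hz
      -- Setting coordinate `j` to `1` lands in the smaller set, which is connected and contains
      -- `(1, …, 1)`. By `ih` the loops avoid `0` over it, so the degree is still zero at this point
      -- and the whole `j`-disc through it is free of zeros.
      have hy : Function.update z j 1 ∈ partialPolydisc s := by
        rw [mem_partialPolydisc]
        intro i
        rcases eq_or_ne i j with rfl | hi
        · simp
        · simpa [hi] using hz i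
      have h1 : (fun _ => 1) ∈ partialPolydisc s := by simp [mem_partialPolydisc]
      have hd := (hasLoopDegree_iff_of_isPreconnected (continuous_coordLoop F j)
        (coordLoop_periodic F j) (isPreconnected_partialPolydisc s)
        (fun y hy θ => ih _ (update_mul_mem_partialPolydisc hy j (norm_exp_ofReal_mul_I θ)))
        h1 hy).1 (hdeg j)
      rw [hasLoopDegree_coordLoop_iff F j _
        fun w hw => ih _ (update_mul_mem_partialPolydisc hy j hw)] at hd
      simpa using hd (z j) (hz j).1
  exact key Finset.univ z (mem_partialPolydisc.2 fun i => ⟨hz i, by simp⟩)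

lemma logMap_update_mul (ζ : Fin n → ℂ) (j : Fin n) {w : ℂ} (hw : ‖w‖ = 1) :
    logMap (Function.update ζ j (ζ j * w)) = logMap ζ := by
  funext i
  rcases eq_or_ne i j with rfl | hi
  · simp [logMap, hw]
  · simp [logMap, hi]

lemma zero_notMem_amoeba_iff {F : MvPolynomial (Fin n) ℂ} : (0 : Fin n → ℝ) ∉ amoeba F ↔
    ∀ z : Fin n → ℂ, (∀ i, ‖z i‖ = 1) → MvPolynomial.eval z F ≠ 0 := by
  refine ⟨fun h z hz h0 => h ⟨z, ⟨fun i hi => ?_, h0⟩, ?_⟩, ?_⟩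
  · simpa [hi] using hz i
  · funext i
    simp [logMap, hz i]
  · rintro h ⟨z, ⟨hz, h0⟩, hl⟩
    refine h z (fun i => ?_) h0
    have := congrFun hl i
    exact Real.eq_one_of_pos_of_log_eq_zero (norm_pos_iff.2 (hz i)) this

/-- The order of the component of the origin vanishes as soon as the winding numbers at one point
of the unit torus (which may depend on the direction) vanish. -/
lemma zero_mem_componentOfOrder_zero_iff {F : MvPolynomial (Fin n) ℂ}
    (h0 : (0 : Fin n → ℝ) ∉ amoeba F) {x : Fin n → Fin n → ℂ} (hx : ∀ j i, ‖x j i‖ = 1) :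
    (0 : Fin n → ℝ) ∈ componentOfOrder F 0 ↔ ∀ j, HasLoopDegree (coordLoop F j (x j)) 0 := by
  have hxE : ∀ j, logMap (x j) = 0 := fun j => funext fun i => by simp [logMap, hx]
  have hx0 : ∀ j i, x j i ≠ 0 := fun j i h => by simpa [h] using hx j i
  constructor
  · rintro ⟨E, ⟨-, hE⟩, hE0⟩ j
    exact hE (x j) (hx0 j) (by rwa [hxE j]) j
  · intro h
    set E := connectedComponentIn (amoeba F)ᶜ 0
    have hE0 : (0 : Fin n → ℝ) ∈ E := mem_connectedComponentIn h0
    refine ⟨E, ⟨⟨0, h0, rfl⟩, fun ζ hζ hζE j => ?_⟩, hE0⟩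
    set Z : Set (Fin n → ℂ) := {ζ | (∀ i, ζ i ≠ 0) ∧ logMap ζ ∈ E} with hZ
    -- Polar coordinates present `Z` as a continuous image of `E × ℝⁿ`.
    have hZc : IsPreconnected Z := by
      have himg : Z = (fun p : (Fin n → ℝ) × (Fin n → ℝ) => fun i => exp (p.1 i + p.2 i * I)) ''
          (E ×ˢ Set.univ) := by
        ext ζ
        constructor
        · rintro ⟨h1, h2⟩
          refine ⟨(logMap ζ, fun i => arg (ζ i)), ⟨h2, trivial⟩, funext fun i => ?_⟩
          change exp ((Real.log ‖ζ i‖ : ℝ) + arg (ζ i) * I) = ζ i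
          exact exp_log (h1 i)
        · rintro ⟨p, ⟨hp, -⟩, rfl⟩
          refine ⟨fun i => exp_ne_zero _, ?_⟩
          convert hp using 1
          funext i
          simp [logMap, norm_exp]
      rw [himg]
      refine (isPreconnected_connectedComponentIn.prod isPreconnected_univ).image _ ?_
      exact (by fun_prop : Continuous _).continuousOn
    have hZ0 : ∀ ζ ∈ Z, ∀ θ, coordLoop F j ζ θ ≠ 0 := by
      rintro ζ ⟨h1, h2⟩ θ h3
      refine connectedComponentIn_subset _ _ h2 ⟨_, ⟨fun i => ?_, h3⟩,
        logMap_update_mul ζ j (norm_exp_ofReal_mul_I θ)⟩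
      rcases eq_or_ne i j with rfl | hi
      · simpa using h1 i
      · simpa [hi] using h1 i
    exact (hasLoopDegree_iff_of_isPreconnected (continuous_coordLoop F j) (coordLoop_periodic F j)
      hZc hZ0 ⟨hx0 j, by rwa [hxE j]⟩ ⟨hζ, hζE⟩).1 (h j)

end Winding

/-! ### Elimination -/

open Polynomial in
/-- Relatively prime polynomials over a factorial ring have a nonzero constant in the ideal they
generate. -/
lemma exists_mul_add_mul_eq_C {R : Type*} [CommRing R] [IsDomain R] [UniqueFactorizationMonoid R]
    {f g : R[X]} (h : IsRelPrime f g) : ∃ a b : R[X], ∃ r : R, r ≠ 0 ∧ a * f + b * g = C r := by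
  classical
  let : NormalizedGCDMonoid R := Classical.choice inferInstance
  let K := FractionRing R
  have hinj : Function.Injective (algebraMap R K) := IsFractionRing.injective R K
  have hspec : ∀ d : K[X], ∃ c : R, c ≠ 0 ∧ ∃ d' : R[X],
      d'.map (algebraMap R K) = C (algebraMap R K c) * d := by
    intro d
    obtain ⟨c, hc0, hc⟩ := IsLocalization.integerNormalization_spec (nonZeroDivisors R) d
    refine ⟨c, nonZeroDivisors.ne_zero hc0, _, hc.trans ?_⟩
    rw [Algebra.smul_def, Polynomial.algebraMap_apply]
  -- Gauss's lemma: a common divisor over the fraction field, cleared of denominators and made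
  -- primitive, already divides `f` and `g` over `R`, so it is a unit.
  have hcop : IsCoprime (f.map (algebraMap R K)) (g.map (algebraMap R K)) := by
    refine IsRelPrime.isCoprime fun d hdf hdg => ?_
    obtain ⟨c, hc0, d', hd'⟩ := hspec d
    have hu : IsUnit (C (algebraMap R K c)) :=
      isUnit_C.2 (isUnit_iff_ne_zero.2 ((map_ne_zero_iff _ hinj).2 hc0))
    have hd0 : d ≠ 0 := by
      rintro rfl
      rw [zero_dvd_iff, Polynomial.map_eq_zero_iff hinj] at hdf hdg
      rw [hdf, hdg] at h
      exact not_isRelPrime_zero_zero h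
    have hd'0 : d' ≠ 0 := by
      rintro rfl
      rw [Polynomial.map_zero] at hd'
      exact mul_ne_zero hu.ne_zero hd0 hd'.symm
    have hp : d'.primPart.IsPrimitive := d'.isPrimitive_primPart
    have hpd : d'.primPart.map (algebraMap R K) ∣ C (algebraMap R K c) * d := by
      rw [← hd']
      exact Polynomial.map_dvd _ d'.primPart_dvd
    have hpu : IsUnit d'.primPart :=
      h (hp.dvd_of_fraction_map_dvd_fraction_map (hpd.trans (hu.mul_left_dvd.2 hdf)))
        (hp.dvd_of_fraction_map_dvd_fraction_map (hpd.trans (hu.mul_left_dvd.2 hdg)))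
    have hmu : IsUnit (d'.map (algebraMap R K)) := by
      rw [d'.eq_C_content_mul_primPart, Polynomial.map_mul, map_C]
      refine IsUnit.mul (isUnit_C.2 (isUnit_iff_ne_zero.2 ((map_ne_zero_iff _ hinj).2 ?_)))
        (hpu.map (mapRingHom (algebraMap R K)))
      rwa [Ne, content_eq_zero_iff]
    rw [hd'] at hmu
    exact isUnit_of_mul_isUnit_right hmu
  obtain ⟨a, b, hab⟩ := hcop
  obtain ⟨c, hc0, a', ha'⟩ := hspec a
  obtain ⟨e, he0, b', hb'⟩ := hspec b
  refine ⟨C e * a', C c * b', c * e, mul_ne_zero hc0 he0, ?_⟩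
  apply Polynomial.map_injective _ hinj
  simp only [Polynomial.map_add, Polynomial.map_mul, map_C, ha', hb', map_mul]
  linear_combination (C (algebraMap R K c) * C (algebraMap R K e)) * hab

section

variable {σ : Type*} [DecidableEq σ]

/-- `MvPolynomial σ ℂ` as a polynomial ring in the variable `j`. -/
noncomputable def splitVariable (j : σ) :
    MvPolynomial σ ℂ ≃ₐ[ℂ] Polynomial (MvPolynomial {i // i ≠ j} ℂ) :=
  (MvPolynomial.renameEquiv ℂ (Equiv.optionSubtypeNe j).symm).trans
    (MvPolynomial.optionEquivLeft ℂ {i // i ≠ j})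

lemma eval_splitVariable (j : σ) (z : σ → ℂ) (F : MvPolynomial σ ℂ) :
    ((splitVariable j F).map (MvPolynomial.eval fun i : {i // i ≠ j} => z i)).eval (z j) =
      MvPolynomial.eval z F := by
  induction F using MvPolynomial.induction_on with
  | C a => simp [splitVariable, MvPolynomial.optionEquivLeft_C]
  | add p q hp hq => simp [hp, hq]
  | mul_X p i hp =>
    have hX : ((splitVariable j (MvPolynomial.X i)).map
        (MvPolynomial.eval fun i : {i // i ≠ j} => z i)).eval (z j) = z i := by
      rcases eq_or_ne i j with rfl | hi
      · simp [splitVariable]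
      · simp [splitVariable, Equiv.optionSubtypeNe_symm_of_ne hi]
    rw [map_mul, Polynomial.map_mul, Polynomial.eval_mul, hp, hX, map_mul, MvPolynomial.eval_X]

/-- Two relatively prime polynomials have no common zero over a generic point of the unit torus in
the variables other than `j`. -/
lemma exists_torus_no_common_zero (j : σ) {F Q : MvPolynomial σ ℂ} (h : IsRelPrime F Q) :
    ∃ ζ : σ → ℂ, (∀ i, ‖ζ i‖ = 1) ∧ ∀ w : ℂ, MvPolynomial.eval (Function.update ζ j w) F = 0 →
      MvPolynomial.eval (Function.update ζ j w) Q ≠ 0 := by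
  have h' : IsRelPrime (splitVariable j F) (splitVariable j Q) := by
    intro d hF hQ
    have := h (d := (splitVariable j).symm d)
      (by simpa using map_dvd (splitVariable j).symm hF)
      (by simpa using map_dvd (splitVariable j).symm hQ)
    simpa using this.map (splitVariable j)
  obtain ⟨a, b, r, hr, hab⟩ := exists_mul_add_mul_eq_C h'
  have hinf : (Metric.sphere (0 : ℂ) 1).Infinite :=
    (isPreconnected_sphere (by simp [rank_real_complex]) _ _).infinite_of_nontrivial
      ⟨1, by simp, -1, by simp, by norm_num [Complex.ext_iff]⟩
  -- A nonzero polynomial cannot vanish on a product of infinite sets. Where the eliminant `r` is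
  -- nonzero, the Bézout identity forbids common zeros.
  obtain ⟨x, hx, hxr⟩ : ∃ x ∈ Set.pi Set.univ fun _ : {i // i ≠ j} => Metric.sphere (0 : ℂ) 1,
      MvPolynomial.eval x r ≠ 0 := by
    by_contra! hcon
    exact hr (MvPolynomial.funext_set _ (fun _ => hinf) fun x hx => by simpa using hcon x hx)
  refine ⟨fun i => if hi : i ≠ j then x ⟨i, hi⟩ else 1, fun i => ?_, fun w h1 h2 => hxr ?_⟩
  · dsimp only
    split_ifs with hi
    · simpa using hx ⟨i, hi⟩ trivial
    · simp
  · set z : σ → ℂ := Function.update (fun i => if hi : i ≠ j then x ⟨i, hi⟩ else 1) j w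
    have hz : (fun i : {i // i ≠ j} => z i) = x := funext fun i => by simp [z, i.2]
    rw [← eval_splitVariable j, hz] at h1 h2
    have := congrArg (fun p => (p.map (MvPolynomial.eval x)).eval (z j)) hab
    simpa [h1, h2] using this.symm

end

/-! ### Inversion in the Wiener algebra -/

section Wiener

variable {ι : Type*}

lemma lp_one_summable_norm (f : lp (fun _ : ι => ℂ) 1) : Summable fun k => ‖f k‖ := by
  simpa using (lp.memℓp f).summable (by simp)

lemma lp_one_norm_eq_tsum (f : lp (fun _ : ι => ℂ) 1) : ‖f‖ = ∑' k, ‖f k‖ := by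
  simpa using lp.norm_eq_tsum_rpow (by simp : 0 < (1 : ENNReal).toReal) f

/-- Reindexing of summable families. -/
noncomputable def lpReindex (e : ι ≃ ι) :
    lp (fun _ : ι => ℂ) 1 →L[ℂ] lp (fun _ : ι => ℂ) 1 :=
  LinearMap.mkContinuous
    { toFun := fun f => ⟨fun k => f (e k), memℓp_gen (by
        simpa [Function.comp_def] using
          (e.summable_iff (f := fun k => ‖f k‖)).2 (lp_one_summable_norm f))⟩
      map_add' := fun _ _ => rfl
      map_smul' := fun _ _ => rfl } 1 fun f => by
    rw [one_mul, lp_one_norm_eq_tsum, lp_one_norm_eq_tsum]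
    exact (e.tsum_eq fun k => ‖f k‖).le

@[simp] lemma lpReindex_apply (e : ι ≃ ι) (f : lp (fun _ : ι => ℂ) 1) (k : ι) :
    lpReindex e f k = f (e k) := rfl

lemma norm_lpReindex_le (e : ι ≃ ι) : ‖lpReindex e‖ ≤ 1 :=
  LinearMap.mkContinuous_norm_le _ zero_le_one _

variable {n : ℕ}

lemma intExponent_zero : intExponent (0 : Fin n →₀ ℕ) = 0 := by
  funext i
  simp [intExponent]

lemma intExponent_add (a b : Fin n →₀ ℕ) : intExponent (a + b) = intExponent a + intExponent b := by
  funext i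
  simp [intExponent]

/-- The operator of convolution with the Laurent polynomial `F` on `ℓ¹(ℤⁿ)`. -/
noncomputable def convOp : MvPolynomial (Fin n) ℂ →ₐ[ℂ]
    (lp (fun _ : Fin n → ℤ => ℂ) 1 →L[ℂ] lp (fun _ : Fin n → ℤ => ℂ) 1) :=
  AddMonoidAlgebra.lift ℂ _ _
    { toFun := fun a => lpReindex (Equiv.subRight (intExponent a.toAdd))
      map_one' := by
        ext f k
        simp [intExponent_zero]
      map_mul' := fun a b => by
        ext f k
        simp [sub_sub, intExponent_add] }

lemma convOp_apply (F : MvPolynomial (Fin n) ℂ) (f : lp (fun _ : Fin n → ℤ => ℂ) 1)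
    (k : Fin n → ℤ) : convOp F f k = ∑ a ∈ F.support, F.coeff a * f (k - intExponent a) := by
  have : convOp F = ∑ a ∈ F.support,
      F.coeff a • lpReindex (Equiv.subRight (intExponent a)) := by
    rw [convOp, AddMonoidAlgebra.lift_apply]
    rfl
  rw [this]
  rw [sum_apply, lp.coeFn_sum, Finset.sum_apply]
  rfl

lemma norm_convOp_X_le (i : Fin n) : ‖convOp (MvPolynomial.X i : MvPolynomial (Fin n) ℂ)‖ ≤ 1 := by
  have : convOp (MvPolynomial.X i : MvPolynomial (Fin n) ℂ) =
      lpReindex (Equiv.subRight (intExponent (Finsupp.single i 1))) := by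
    ext f k
    rw [convOp_apply]
    simp [MvPolynomial.support_X]
  rw [this]
  exact norm_lpReindex_le _

/-- Inversion in the closed algebra generated by commuting contractions: a polynomial without zeros
in the closed unit polydisc takes an invertible value. -/
lemma exists_right_inverse_mem_closure {B : Type*} [NormedRing B] [NormedAlgebra ℂ B]
    [CompleteSpace B] [NormOneClass B] {σ : Type*} (T : MvPolynomial σ ℂ →ₐ[ℂ] B)
    (hT : ∀ i, ‖T (MvPolynomial.X i)‖ ≤ 1) (F : MvPolynomial σ ℂ)
    (hF : ∀ z : σ → ℂ, (∀ i, ‖z i‖ ≤ 1) → MvPolynomial.eval z F ≠ 0) :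
    ∃ u ∈ T.range.topologicalClosure, T F * u = 1 := by
  let A := T.range.topologicalClosure
  have hcomm : ∀ x y : T.range, x * y = y * x := by
    rintro ⟨_, p, rfl⟩ ⟨_, q, rfl⟩
    exact Subtype.ext (by simp [← map_mul, mul_comm])
  have hcomplete : CompleteSpace A :=
    (Subalgebra.isClosed_topologicalClosure _).completeSpace_coe
  let instA : NormedCommRing A :=
    { (inferInstance : NormedRing A) with
      mul_comm := (Subalgebra.commRingTopologicalClosure _ hcomm).mul_comm }
  have : NormOneClass A := ⟨norm_one (α := B)⟩
  let Φ : MvPolynomial σ ℂ →ₐ[ℂ] A :=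
    (Subalgebra.inclusion (Subalgebra.le_topologicalClosure _)).comp T.rangeRestrict
  have hunit : IsUnit (Φ F) := by
    by_contra hnot
    -- A non-unit of a commutative Banach algebra is killed by a character. Characters are
    -- contractive, so the images of the variables form a zero of `F` in the closed polydisc.
    obtain ⟨χ, hχ⟩ := WeakDual.CharacterSpace.exists_apply_eq_zero hnot
    let ψ : A →ₐ[ℂ] ℂ := WeakDual.CharacterSpace.toAlgHom χ
    have hψ : ψ.comp Φ = MvPolynomial.aeval fun i => ψ (Φ (MvPolynomial.X i)) :=
      MvPolynomial.aeval_unique _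
    refine hF (fun i => ψ (Φ (MvPolynomial.X i))) (fun i => ?_) ?_
    · exact (AlgHom.norm_apply_le_self ψ _).trans (hT i)
    · rw [← MvPolynomial.coe_aeval_eq_eval, RingHom.coe_coe, ← hψ]
      exact hχ
  obtain ⟨u, hu⟩ := hunit.exists_right_inv
  exact ⟨u, u.2, congrArg Subtype.val hu⟩

/-- If `F` has no zero in the closed polydisc, then the coefficients of the power series of `1/F`
are summable. -/
lemma exists_summable_inverse (F : MvPolynomial (Fin n) ℂ)
    (hF : ∀ z : Fin n → ℂ, (∀ i, ‖z i‖ ≤ 1) → MvPolynomial.eval z F ≠ 0) :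
    ∃ h : (Fin n → ℤ) → ℂ, (Summable fun k => ‖h k‖) ∧ (∀ k, h k ≠ 0 → 0 ≤ k) ∧
      ∀ k, ∑ a ∈ F.support, F.coeff a * h (k - intExponent a) = if k = 0 then 1 else 0 := by
  let V := lp (fun _ : Fin n → ℤ => ℂ) 1
  let δ : V := lp.single 1 0 (1 : ℂ)
  have : Nontrivial V := ⟨δ, 0, fun h => by
    have := congrArg (fun f : V => f 0) h
    simp [δ] at this⟩
  obtain ⟨u, hu, hFu⟩ := exists_right_inverse_mem_closure (B := V →L[ℂ] V) convOp
    norm_convOp_X_le F hF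
  refine ⟨u δ, lp_one_summable_norm _, fun k hk => ?_, fun k => ?_⟩
  · by_contra hk0
    refine hk ?_
    have hcont : Continuous fun T : V →L[ℂ] V => T δ k :=
      (lp.evalCLM ℂ (fun _ : Fin n → ℤ => ℂ) 1 k).continuous.comp (by fun_prop)
    -- Vanishing of the kernel at `k` is a closed condition, true for polynomials when `k` is
    -- outside the orthant; hence it passes to `u`.
    have hclosed : IsClosed {T : V →L[ℂ] V | T δ k = 0} := isClosed_eq hcont continuous_const
    refine closure_minimal ?_ hclosed hu
    rintro _ ⟨p, rfl⟩
    change convOp p δ k = 0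
    rw [convOp_apply]
    refine Finset.sum_eq_zero fun a _ => ?_
    have : k - intExponent a ≠ 0 := fun h => hk0 fun i => by
      rw [sub_eq_zero.1 h]
      exact Int.natCast_nonneg _
    rw [lp.single_apply_ne _ _ _ this, mul_zero]
  · rw [← convOp_apply, ← mul_apply_eq_comp, hFu, one_apply_eq_self, lp.coeFn_single]
    simp [Pi.single_apply]

end Wiener

/-! ### Rational filters -/

section Filters

variable {n : ℕ}

/-- The linear time invariant system with impulse response `h`. -/
noncomputable def systemOfImpulseResponse (h : (Fin n → ℤ) → ℂ) : DiscreteSystem n :=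
  fun u k => ∑ m ∈ u.support, h (k - m) * u m

@[simp] lemma impulseResponse_systemOfImpulseResponse (h : (Fin n → ℤ) → ℂ) :
    impulseResponse (systemOfImpulseResponse h) = h := by
  funext k
  rw [impulseResponse, systemOfImpulseResponse, Finsupp.support_single _ one_ne_zero]
  simp

/-- A formal Laurent series supported in a translate of the orthant and annihilated by a polynomial
with nonzero constant term vanishes. -/
lemma eq_zero_of_conv_eq_zero {F : MvPolynomial (Fin n) ℂ} (hF : F.coeff 0 ≠ 0)
    {d : (Fin n → ℤ) → ℂ} {M : Fin n → ℤ} (hM : ∀ k, d k ≠ 0 → M ≤ k)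
    (hd : ∀ k, ∑ a ∈ F.support, F.coeff a * d (k - intExponent a) = 0) (k : Fin n → ℤ) :
    d k = 0 := by
  -- Induction on the height of `k` above `M`: in the equation at `k`, all terms but the constant
  -- one involve `d` at strictly smaller height.
  have key : ∀ N : ℕ, ∀ k, ∑ i, (k i - M i) < N → d k = 0 := by
    intro N
    induction N with
    | zero =>
      intro k hk
      by_contra hk0
      exact absurd hk (not_lt.2 (by
        simpa using Finset.sum_nonneg fun i _ => sub_nonneg.2 (hM k hk0 i)))
    | succ N ih =>
      intro k hk
      have h0 : (0 : Fin n →₀ ℕ) ∈ F.support := MvPolynomial.mem_support_iff.2 hF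
      have h1 := hd k
      rw [← Finset.add_sum_erase _ _ h0, Finset.sum_eq_zero, add_zero, intExponent_zero, sub_zero]
        at h1
      · exact (mul_eq_zero.1 h1).resolve_left hF
      · intro a ha
        rw [ih, mul_zero]
        have ha0 : a ≠ 0 := Finset.ne_of_mem_erase ha
        obtain ⟨i, hi⟩ := Finsupp.ne_iff.1 ha0
        have hpos : 0 < ∑ i, (a i : ℤ) :=
          Finset.sum_pos' (fun _ _ => Int.natCast_nonneg _)
            ⟨i, Finset.mem_univ i, by exact_mod_cast Nat.pos_of_ne_zero hi⟩
        have : ∑ i, ((k - intExponent a) i - M i) = ∑ i, (k i - M i) - ∑ i, (a i : ℤ) := by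
          rw [← Finset.sum_sub_distrib]
          exact Finset.sum_congr rfl fun i _ => by simp only [Pi.sub_apply, intExponent]; ring
        push_cast at hk
        omega
  refine key ((∑ i, (k i - M i)).toNat + 1) k ?_
  push_cast
  omega

/-- The impulse response of a rational filter is determined by its transfer function, provided that
the denominator has a nonzero constant term. -/
lemma IsRationalFilter.impulseResponse_unique {S T : DiscreteSystem n} {γ : Fin n → ℤ}
    {G F : MvPolynomial (Fin n) ℂ} (hF : F.coeff 0 ≠ 0) (hS : IsRationalFilter S γ G F)
    (hT : IsRationalFilter T γ G F) : impulseResponse S = impulseResponse T := by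
  obtain ⟨M, hM⟩ := hS.realizable
  obtain ⟨N, hN⟩ := hT.realizable
  funext k
  refine sub_eq_zero.1 (eq_zero_of_conv_eq_zero hF
    (d := fun k => impulseResponse S k - impulseResponse T k) (M := M ⊓ N) (fun k hk => ?_)
    (fun k => ?_) k)
  · by_cases h : impulseResponse S k = 0
    · exact inf_le_right.trans (hN k fun h' => hk (by simp only [h, h', sub_zero]))
    · exact inf_le_left.trans (hM k h)
  · simp only [mul_sub, Finset.sum_sub_distrib]
    rw [hS.transfer, hT.transfer, sub_self]

/-- If the denominator has no zero in the closed polydisc then there is a stable filter. -/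
lemma exists_isRationalFilter_isBIBOStable (γ : Fin n → ℤ) (G F : MvPolynomial (Fin n) ℂ)
    (hF : ∀ z : Fin n → ℂ, (∀ i, ‖z i‖ ≤ 1) → MvPolynomial.eval z F ≠ 0) :
    ∃ S : DiscreteSystem n, IsRationalFilter S γ G F ∧ IsBIBOStable S := by
  obtain ⟨h, hsum, hsupp, hinv⟩ := exists_summable_inverse F hF
  set q : (Fin n → ℤ) → ℂ := fun k => ∑ b ∈ G.support, G.coeff b * h (k - (γ + intExponent b))
    with hq
  refine ⟨systemOfImpulseResponse q, ⟨?_, ?_, ?_⟩, ?_⟩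
  · intro u k
    rw [impulseResponse_systemOfImpulseResponse]
    rfl
  · refine ⟨γ, fun k hk => ?_⟩
    rw [impulseResponse_systemOfImpulseResponse] at hk
    obtain ⟨b, -, hb⟩ := Finset.exists_ne_zero_of_sum_ne_zero hk
    have := hsupp _ (right_ne_zero_of_mul hb)
    intro i
    have hi := this i
    change γ i ≤ k i
    simp only [Pi.zero_apply, Pi.sub_apply, Pi.add_apply, intExponent] at hi
    omega
  · intro k
    rw [impulseResponse_systemOfImpulseResponse, shiftedCoeff]
    simp only [hq, Finset.mul_sum]
    rw [Finset.sum_comm]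
    refine Finset.sum_congr rfl fun b _ => ?_
    have := hinv (k - (γ + intExponent b))
    simp only [sub_eq_zero] at this
    calc _ = G.coeff b * ∑ a ∈ F.support,
          F.coeff a * h (k - (γ + intExponent b) - intExponent a) := by
          rw [Finset.mul_sum]
          refine Finset.sum_congr rfl fun a _ => ?_
          rw [sub_right_comm]
          ring
      _ = _ := by rw [this, mul_ite, mul_one, mul_zero]
  · rw [IsBIBOStable, impulseResponse_systemOfImpulseResponse]
    refine Summable.of_nonneg_of_le (fun _ => norm_nonneg _) (fun k => norm_sum_le _ _)
      (summable_sum fun b _ => ?_)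
    simp only [norm_mul]
    exact ((Equiv.subRight (γ + intExponent b)).summable_iff.2 hsum).mul_left _

/-- The monomial `z^k`, for `k` in the orthant `ℕⁿ`. -/
noncomputable def orthantMonomial (z : Fin n → ℂ) (k : Fin n → ℤ) : ℂ := ∏ i, z i ^ (k i).toNat

lemma norm_orthantMonomial_le {z : Fin n → ℂ} (hz : ∀ i, ‖z i‖ ≤ 1) (k : Fin n → ℤ) :
    ‖orthantMonomial z k‖ ≤ 1 := by
  rw [orthantMonomial, norm_prod]
  refine Finset.prod_le_one (fun _ _ => norm_nonneg _) fun i _ => ?_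
  rw [norm_pow]
  exact pow_le_one₀ (norm_nonneg _) (hz i)

lemma orthantMonomial_add_intExponent (z : Fin n → ℂ) {k : Fin n → ℤ} (hk : 0 ≤ k)
    (a : Fin n →₀ ℕ) :
    orthantMonomial z (k + intExponent a) = (∏ i, z i ^ a i) * orthantMonomial z k := by
  rw [orthantMonomial, orthantMonomial, ← Finset.prod_mul_distrib]
  refine Finset.prod_congr rfl fun i _ => ?_
  rw [← pow_add]
  congr 1
  have := hk i
  simp only [Pi.zero_apply, Pi.add_apply, intExponent] at this ⊢
  omega

/-- The transfer function of a stable filter, evaluated in the closed polydisc. -/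
lemma IsRationalFilter.exists_eval_mul_eq {S : DiscreteSystem n} {γ : Fin n → ℤ}
    {G F : MvPolynomial (Fin n) ℂ} (hS : IsRationalFilter S γ G F) (hstab : IsBIBOStable S) :
    ∃ c : Fin n → ℕ, ∀ z : Fin n → ℂ, (∀ i, ‖z i‖ ≤ 1) → ∃ H : ℂ,
      MvPolynomial.eval z F * H = MvPolynomial.eval z ((∏ i, MvPolynomial.X i ^ c i) * G) := by
  obtain ⟨M', hM'⟩ := hS.realizable
  -- Lowering the corner below `γ` makes `X^(γ - M) G` a genuine polynomial.
  set M := M' ⊓ γ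
  have hM : ∀ k, impulseResponse S k ≠ 0 → M ≤ k := fun k hk => inf_le_left.trans (hM' k hk)
  have hMγ : 0 ≤ γ - M := sub_nonneg.2 inf_le_right
  set h := impulseResponse S with hh
  refine ⟨fun i => (γ i - M i).toNat, fun z hz => ?_⟩
  -- The factor `z^(-M)` leaves only nonnegative exponents on the support of `h`, so the series
  -- converges even where coordinates of `z` vanish.
  set e : (Fin n → ℤ) → ℂ := fun k => orthantMonomial z (k - M) with he
  have hsum : Summable fun k => h k * e k := by
    refine Summable.of_norm_bounded hstab fun k => ?_
    rw [norm_mul]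
    exact mul_le_of_le_one_right (norm_nonneg _) (norm_orthantMonomial_le hz _)
  -- Truncation by `toNat` is harmless: either the coefficient vanishes or `k - a` lies above `M`.
  have hshift : ∀ (a : Fin n →₀ ℕ) (k : Fin n → ℤ), h (k - intExponent a) * e k =
      (∏ i, z i ^ a i) * (h (k - intExponent a) * e (k - intExponent a)) := by
    intro a k
    by_cases hk : h (k - intExponent a) = 0
    · simp [hk]
    · have := orthantMonomial_add_intExponent z (sub_nonneg.2 (hM _ hk)) a
      rw [show k - intExponent a - M + intExponent a = k - M by abel] at this
      simp only [he, this]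
      ring
  have hsum' : ∀ a : Fin n →₀ ℕ,
      HasSum (fun k => h (k - intExponent a) * e k) ((∏ i, z i ^ a i) * ∑' k, h k * e k) := by
    intro a
    simp only [hshift]
    exact ((Equiv.subRight (intExponent a)).hasSum_iff.2 hsum.hasSum).mul_left _
  have hF : HasSum (fun k => ∑ a ∈ F.support, F.coeff a * (h (k - intExponent a) * e k))
      (MvPolynomial.eval z F * ∑' k, h k * e k) := by
    rw [MvPolynomial.eval_eq', Finset.sum_mul]
    refine hasSum_sum fun a _ => ?_
    rw [mul_assoc]
    exact (hsum' a).mul_left _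
  have hG : HasSum (fun k => shiftedCoeff γ G k * e k)
      (MvPolynomial.eval z ((∏ i, MvPolynomial.X i ^ (γ i - M i).toNat) * G)) := by
    rw [map_mul, MvPolynomial.eval_eq' z G, Finset.mul_sum]
    simp only [shiftedCoeff, Finset.sum_mul]
    refine hasSum_sum fun b _ => ?_
    convert hasSum_single (γ + intExponent b) _ using 1
    · rw [if_pos rfl]
      simp only [he]
      rw [show γ + intExponent b - M = γ - M + intExponent b by abel,
        orthantMonomial_add_intExponent z hMγ]
      simp only [orthantMonomial, map_prod, map_pow, MvPolynomial.eval_X, Pi.sub_apply]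
      ring
    · intro k hk
      rw [if_neg hk, zero_mul]
  refine ⟨_, hF.unique ?_⟩
  convert hG using 2 with k
  rw [← hS.transfer, Finset.sum_mul]
  exact Finset.sum_congr rfl fun a _ => by rw [mul_assoc]

/-- The winding numbers of the denominator of a stable filter vanish at some point of the torus. -/
lemma IsRationalFilter.exists_hasLoopDegree_zero {S : DiscreteSystem n} {γ : Fin n → ℤ}
    {G F : MvPolynomial (Fin n) ℂ} (hS : IsRationalFilter S γ G F) (hstab : IsBIBOStable S)
    (hGF : IsRelPrime G F) (hF : IsRelPrime F (∏ i : Fin n, MvPolynomial.X i))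
    (h0 : (0 : Fin n → ℝ) ∉ amoeba F) (j : Fin n) :
    ∃ ζ : Fin n → ℂ, (∀ i, ‖ζ i‖ = 1) ∧ HasLoopDegree (coordLoop F j ζ) 0 := by
  obtain ⟨c, hc⟩ := hS.exists_eval_mul_eq hstab
  -- The monomial clearing negative exponents adds no common factor, since `F` is coprime with every
  -- variable.
  have hrel : IsRelPrime F ((∏ i, MvPolynomial.X i ^ c i) * G) :=
    (IsRelPrime.prod_right fun i _ =>
      (hF.of_prod_right i (Finset.mem_univ i)).pow_right).mul_right hGF.symm
  obtain ⟨ζ, hζ, hζF⟩ := exists_torus_no_common_zero j hrel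
  have hupd : ∀ w : ℂ, ∀ i, ‖Function.update ζ j (ζ j * w) i‖ = if i = j then ‖w‖ else 1 := by
    intro w i
    rcases eq_or_ne i j with rfl | hi
    · simp [hζ]
    · simp [hi, hζ]
  refine ⟨ζ, hζ, (hasLoopDegree_coordLoop_iff F j ζ fun w hw => ?_).2 fun w hw hz => ?_⟩
  · refine zero_notMem_amoeba_iff.1 h0 _ fun i => ?_
    rw [hupd, hw, ite_self]
  · obtain ⟨H, hH⟩ := hc (Function.update ζ j (ζ j * w)) fun i => by
      rw [hupd]
      split_ifs
      exacts [hw, le_rfl]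
    rw [hz, zero_mul] at hH
    exact hζF _ hz hH.symm

lemma coeff_zero_ne_zero_of_eval_ne_zero {F : MvPolynomial (Fin n) ℂ}
    (hF : ∀ z : Fin n → ℂ, (∀ i, ‖z i‖ ≤ 1) → MvPolynomial.eval z F ≠ 0) : F.coeff 0 ≠ 0 := by
  have := hF 0 (by simp)
  rwa [MvPolynomial.eval_zero, MvPolynomial.constantCoeff_eq] at this

end Filters

theorem theorem3p1 (n : ℕ) (F G : MvPolynomial (Fin n) ℂ) (γ : Fin n → ℤ)
    (hGF : IsRelPrime G F)
    (hF : IsRelPrime F (∏ i : Fin n, MvPolynomial.X i))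
    (hG : IsRelPrime G (∏ i : Fin n, MvPolynomial.X i))
    (hdim : Module.finrank ℝ (affineSpan ℝ (newtonPolytope F)).direction = n)
    (h0 : (0 : Fin n → ℝ) ∉ amoeba F) :
    (∀ S : DiscreteSystem n, IsRationalFilter S γ G F →
      (IsBIBOStable S ↔
        (0 : Fin n →₀ ℕ) ∈ F.support ∧ (0 : Fin n → ℝ) ∈ componentOfOrder F 0)) ∧
    ((∃ S : DiscreteSystem n, IsRationalFilter S γ G F ∧ IsBIBOStable S) ↔
        (0 : Fin n →₀ ℕ) ∈ F.support ∧ (0 : Fin n → ℝ) ∈ componentOfOrder F 0) := by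
  have hpoly : (0 : Fin n → ℝ) ∈ componentOfOrder F 0 →
      ∀ z : Fin n → ℂ, (∀ i, ‖z i‖ ≤ 1) → MvPolynomial.eval z F ≠ 0 := fun h =>
    eval_ne_zero_of_hasLoopDegree_zero F (zero_notMem_amoeba_iff.1 h0)
      ((zero_mem_componentOfOrder_zero_iff h0 (x := fun _ _ => 1) (by simp)).1 h)
  have hforward : ∀ S : DiscreteSystem n, IsRationalFilter S γ G F → IsBIBOStable S →
      (0 : Fin n →₀ ℕ) ∈ F.support ∧ (0 : Fin n → ℝ) ∈ componentOfOrder F 0 := by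
    intro S hS hstab
    -- The torus point depends on the direction `j`.
    choose ζ hζ hdeg using hS.exists_hasLoopDegree_zero hstab hGF hF h0
    have hmem := (zero_mem_componentOfOrder_zero_iff h0 hζ).2 hdeg
    exact ⟨MvPolynomial.mem_support_iff.2
      (coeff_zero_ne_zero_of_eval_ne_zero (hpoly hmem)), hmem⟩
  refine ⟨fun S hS => ⟨hforward S hS, fun h => ?_⟩, fun ⟨S, hS, hstab⟩ => hforward S hS hstab,
    fun h => exists_isRationalFilter_isBIBOStable γ G F (hpoly h.2)⟩
  obtain ⟨T, hT, hTstab⟩ := exists_isRationalFilter_isBIBOStable γ G F (hpoly h.2)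
  rw [IsBIBOStable, hS.impulseResponse_unique (MvPolynomial.mem_support_iff.1 h.1) hT]
  exact hTstab
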